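/- **Setting.** Let $\mathcal G$ be a finite undirected bipartite graph on the peers $1,\dots,n$ (each edge joins a buyer and a seller), with neighbour sets $\mathcal N_i$ and Laplacian $\mathcal L$. Let $a_i>0$, $b_i\in\mathbb R$, let $d_{ij}\in\mathbb R$ $(j\in\mathcal N_i)$ be trade weights, and let $P_i^{\min},P_i^{\max}\in\mathbb R$. For $P=(P_{ij})_{j\in\mathcal N_i}\in\mathbb R^m$, $m=\sum_i|\mathcal N_i|$, put $P_{i,tr}=\sum_{j\in\mathcal N_i}P_{ij}$ and $C_i(P)=a_iP_{i,tr}^2+b_iP_{i,tr}+\sum_{j\in\mathcal N_i}d_{ij}P_{ij}$. Let $\Omega_{eq}=\{P: P_{ij}+P_{ji}=0\ \forall i,\ j\in\mathcal N_i\}$, and let $\Omega_{ineq}$ be either $\{X: P_i^{\min}\le X_{i,tr}\le P_i^{\max}\ \forall i\}$ or the same set with the additional role constraints that $X_{ij}\ge0$ if $i$ is a buyer and $X_{ij}\le 0$ if $i$ is a seller. The trading problem is to minimize $\sum_iC_i(P)$ over $P\in\Omega_{eq}\cap\Omega_{ineq}$. The parallel proximal ADMM with parameters $\rho,\phi,\psi,\kappa>0$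 starts from arbitrary $P^0,X^0,u^0\in\mathbb R^m$ and computes $$X^{k+1}=\operatorname*{arg\,min}_{X\in\Omega_{ineq}}\tfrac\rho2\|P^k-X+u^k\|^2+\tfrac\psi2\|X-X^k\|^2,$$ $$P^{k+1}=\operatorname*{arg\,min}_{P\in\Omega_{eq}}J_k(P),\qquad J_k(P)=\sum_iC_i(P)+\tfrac\rho2\|P-X^k+u^k\|^2+\tfrac\phi2\|P-P^k\|^2,$$ $$u^{k+1}=u^k+\kappa\rho\,(P^{k+1}-X^{k+1}).$$ The prices $\lambda_{ij}^{k+1}=\lambda_{ji}^{k+1}$ are the Lagrange multipliers (one for each pair of neighbours) of the $P$-update: $\lambda^{k+1}_{ij}=\partial J_k/\partial P_{ij}$ at $P^{k+1}$. Put $v_{ij}^k=b_i+d_{ij}+\rho(-X_{ij}^k+u_{ij}^k)-\phi P_{ij}^k$, $\hat v_i^k=\sum_{j\in\mathcal N_i}v_{ji}^k$, $\tilde v_i^k=\sum_{j\in\mathcal N_i}v_{ij}^k$ and $\Gamma=(\rho+\phi)\,\mathrm{diag}\{1/a_i\}$. **Theorem.** (1) For all $\rho,\phi>0$ and all $P^k,X^k,u^k\in\mathbb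 R^m$, the $P$-update has exactly one solution $P^{k+1}$, its Lagrange multipliers exist and are unique, and for all neighbours $i,j$ $$P_{ij}^{k+1}=\frac{v_{ji}^k+2a_jP_{j,tr}^{k+1}-v_{ij}^k-2a_iP_{i,tr}^{k+1}}{2(\rho+\phi)},\qquad \lambda_{ij}^{k+1}=\frac{v_{ji}^k+2a_jP_{j,tr}^{k+1}+v_{ij}^k+2a_iP_{i,tr}^{k+1}}{2},$$ where $(2a_iP_{i,tr}^{k+1})_{i}$ is the unique solution $y$ of $(\mathcal L+\Gamma)\,y=\hat v^k-\tilde v^k$. (2) Let $P^*$ be an optimal solution of the trading problem. Call peer $i$ *successfully traded* if $P^*_{ij}\ne0$ for some $j\in\mathcal N_i$, and assume $P_i^{\min}<P^*_{i,tr}<P_i^{\max}$ for every successfully traded peer. Let $H$ be the graph of the pairs of neighbouring successfully traded peers; if the role constraints are imposed, only the pairs with $P^*_{ij}\neq0$. Then, as $k\to\infty$ and then $\rho\to0$, the total powers and the prices of the transactions converge to their optimal values: there are $p_i(\rho)$ and $\ell_{ij}(\rho)$ such that for each $\rho\in(0,1]$, for all $\phi,\psi,\kappa>0$ with $\phi>\rho(\tfrac1{\mu_1}-1)$,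 $\psi>\rho(\tfrac1{\mu_2}-1)$, $\mu_1+\mu_2<2-\kappa$ for some $\mu_1,\mu_2>0$, and for every run of the algorithm, $P^k_{i,tr}\to p_i(\rho)$ for all $i$ and $\lambda^k_{ij}\to\ell_{ij}(\rho)$ for all edges $ij$ of $H$ as $k\to\infty$; and, as $\rho\to0^+$, $$p_i(\rho)\to P^*_{i,tr}\ \text{ for all } i,\qquad \ell_{ij}(\rho)\to\lambda_{ij}^*:=2a_iP^*_{i,tr}+b_i+d_{ij}=\lambda_{ji}^*\ \text{ for all edges } ij \text{ of } H.$$ These limits are given by the following formulas. (i) If all $d_{ij}=0$ and $H$ is connected on the successfully traded peers, then, with sums over the successfully traded peers, $$\lambda^*_{ij}=\frac{\sum_l b_l/(2a_l)}{\sum_l 1/(2a_l)}\ \text{ on all edges of } H,\qquad P^*_{i,tr}=\frac{\sum_l b_l/(2a_l)}{2a_i\sum_l1/(2a_l)}-\frac{b_i}{2a_i}\ \text{ for all successfully traded } i.$$ (ii) If all $d_{ij}=0$ ($H$ not necessarily connected), the same formulas hold in each connected component of $H$, with sums over that component. (iii) For arbitrary $d_{ij}$, the total powers of the successfully traded peers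 satisfy $[E,\alpha]^T\,(2a_iP^*_{i,tr})_i=[\mathrm{vec}(b_j+d_{ji}-b_i-d_{ij})^T,0]^T$, with $E$ an oriented incidence matrix of $H$ and $\alpha=(1/(2a_i))_i$; that is, $2a_iP^*_{i,tr}-2a_jP^*_{j,tr}=b_j+d_{ji}-b_i-d_{ij}$ for all edges $ij$ of $H$, and $\sum_iP^*_{i,tr}=0$. If $H$ is connected on the successfully traded peers, this system determines their total powers uniquely. -/

import Mathlib

open Filter Topology Matrix

noncomputable section

/-- `x` is a minimizer of `f` over the set `s`. -/
def IsArgmin {α : Type*} (f : α → ℝ) (s : Set α) (x : α) : Prop :=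
  x ∈ s ∧ IsMinOn f s x

/-- A peer-to-peer energy market at one time step on the communication graph `G`.
An ordered pair `(i, j)` of neighbouring peers is a dart `d` of `G`, with `d.fst = i`,
`d.snd = j`, and `d.symm` the pair `(j, i)`. A vector of `ℝ^m`, with `m` the sum of the degrees,
is a function on the darts, and its entry with index `ij` is the value at that dart. -/
structure Market {V : Type*} (G : SimpleGraph V) where
  /-- quadratic cost coefficients -/
  a : V → ℝ
  a_pos : ∀ i, 0 < a i
  /-- linear cost coefficients -/
  b : V → ℝ
  /-- bilateral trade weights -/
  w : G.Dart → ℝ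
  /-- lower bounds of the total traded powers -/
  pmin : V → ℝ
  /-- upper bounds of the total traded powers -/
  pmax : V → ℝ
  /-- the buying peers; the other peers are sellers -/
  buyer : V → Prop
  /-- the graph is bipartite: each edge joins a buyer and a seller -/
  bipartite : ∀ i j, G.Adj i j → (buyer i ↔ ¬ buyer j)

section

variable {V : Type*} [Fintype V] [DecidableEq V] {G : SimpleGraph V} [DecidableRel G.Adj]

/-- The sum over the neighbours `j` of `i` of the entries `ij` of a vector. -/
def rowSum (P : G.Dart → ℝ) (i : V) : ℝ :=
  ∑ d : G.Dart with d.fst = i, P d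

/-- Squared Euclidean norm on `ℝ^m`. -/
def sqNorm (P : G.Dart → ℝ) : ℝ := ∑ d, P d ^ 2

/-- The balance set: `P_ij + P_ji = 0` for all pairs of neighbours. -/
def balanceSet (G : SimpleGraph V) : Set (G.Dart → ℝ) :=
  {P | ∀ d : G.Dart, P d + P d.symm = 0}

namespace Market

variable (M : Market G)

/-- The cost of peer `i`. -/
def cost (P : G.Dart → ℝ) (i : V) : ℝ :=
  M.a i * rowSum P i ^ 2 + M.b i * rowSum P i + rowSum (fun d => M.w d * P d) i

/-- The total cost. -/
def totalCost (P : G.Dart → ℝ) : ℝ := ∑ i, M.cost P i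

/-- The inequality set: the bounds on the total traded powers and, if `signs` holds, the role
constraints: the entries of a buyer are nonnegative, those of a seller nonpositive. -/
def ineqSet (signs : Prop) : Set (G.Dart → ℝ) :=
  {X | (∀ i, M.pmin i ≤ rowSum X i ∧ rowSum X i ≤ M.pmax i) ∧
    (signs → ∀ d : G.Dart,
      (M.buyer d.fst → 0 ≤ X d) ∧ (¬ M.buyer d.fst → X d ≤ 0))}

/-- `P` is an optimal solution of the peer-to-peer trading problem. -/
def IsOptimal (signs : Prop) (P : G.Dart → ℝ) : Prop :=
  IsArgmin M.totalCost (balanceSet G ∩ M.ineqSet signs) P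

/-- The marginal cost `2 a_i P_{i,tr} + b_i + d_ij` of peer `i` in the power `P_ij`, which is the
energy price `λ_ij` at an optimal solution `P`. -/
def marginal (P : G.Dart → ℝ) (d : G.Dart) : ℝ :=
  2 * M.a d.fst * rowSum P d.fst + M.b d.fst + M.w d

/-- The objective of the `P`-update at the current iterates `Pk`, `Xk`, `uk`. -/
def objP (ρ φ : ℝ) (Pk Xk uk P : G.Dart → ℝ) : ℝ :=
  M.totalCost P + ρ / 2 * sqNorm (P - Xk + uk) + φ / 2 * sqNorm (P - Pk)

/-- `v_ij = b_i + d_ij + ρ (-X_ij + u_ij) - φ P_ij`. -/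
def v (ρ φ : ℝ) (Pk Xk uk : G.Dart → ℝ) (d : G.Dart) : ℝ :=
  M.b d.fst + M.w d + ρ * (-Xk d + uk d) - φ * Pk d

/-- `Γ = (ρ + φ) diag (1 / a_i)`. -/
def Gam (ρ φ : ℝ) : Matrix V V ℝ :=
  (ρ + φ) • Matrix.diagonal (fun i => 1 / M.a i)

end Market

/-- The objective of the `X`-update at the current iterates `Pk`, `Xk`, `uk`. -/
def objX (ρ ψ : ℝ) (Pk Xk uk X : G.Dart → ℝ) : ℝ :=
  ρ / 2 * sqNorm (Pk - X + uk) + ψ / 2 * sqNorm (X - Xk)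

/-- `lam` is the system of Lagrange multipliers, one for each pair of neighbours
(so `λ_ij = λ_ji`), of the problem of minimizing `J` over the balance set, at the point `P`:
the partial derivative of `J` in the entry `P_ij` is `λ_ij`. -/
def IsMultiplier (J : (G.Dart → ℝ) → ℝ) (P lam : G.Dart → ℝ) : Prop :=
  ∀ d : G.Dart, lam d = lam d.symm ∧
    HasDerivAt (fun t => J (Function.update P d t)) (lam d) (P d)

namespace Market

variable (M : Market G)

/-- A run of the parallel proximal ADMM, from arbitrary initial values `P 0`, `X 0`, `u 0`, with
the prices `lam (k + 1)` of the `P`-updates (`lam 0` plays no role). -/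
structure IsRun (signs : Prop) (ρ φ ψ κ : ℝ) (P X u lam : ℕ → G.Dart → ℝ) : Prop where
  stepX : ∀ k, IsArgmin (objX ρ ψ (P k) (X k) (u k)) (M.ineqSet signs) (X (k + 1))
  stepP : ∀ k, IsArgmin (M.objP ρ φ (P k) (X k) (u k)) (balanceSet G) (P (k + 1))
  stepU : ∀ k, u (k + 1) = u k + (κ * ρ) • (P (k + 1) - X (k + 1))
  price : ∀ k, IsMultiplier (M.objP ρ φ (P k) (X k) (u k)) (P (k + 1)) (lam (k + 1))

end Market

/-- The condition on the parameters of the algorithm. -/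
def ProxCond (ρ φ ψ κ : ℝ) : Prop :=
  0 < φ ∧ 0 < ψ ∧ 0 < κ ∧ ∃ μ₁ μ₂ : ℝ, 0 < μ₁ ∧ 0 < μ₂ ∧
    φ > ρ * (1 / μ₁ - 1) ∧ ψ > ρ * (1 / μ₂ - 1) ∧ μ₁ + μ₂ < 2 - κ

/-- Peer `i` trades successfully under `P`: it trades a nonzero power with some neighbour. -/
def IsTrader (P : G.Dart → ℝ) (i : V) : Prop :=
  ∃ d : G.Dart, d.fst = i ∧ P d ≠ 0

open Classical in
/-- The successfully traded peers. -/
def traders (P : G.Dart → ℝ) : Finset V :=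
  Finset.univ.filter fun i => IsTrader P i

/-- The pairs of neighbouring successfully traded peers; if the role constraints are imposed, only
those pairs that trade a nonzero power with each other. -/
def IsTrade (signs : Prop) (P : G.Dart → ℝ) (d : G.Dart) : Prop :=
  IsTrader P d.fst ∧ IsTrader P d.snd ∧ (signs → P d ≠ 0)

/-- The communication graph between successfully traded peers. -/
def tradeGraph (signs : Prop) (P : G.Dart → ℝ) : SimpleGraph V :=
  SimpleGraph.fromRel fun i j => ∃ d : G.Dart, d.fst = i ∧ d.snd = j ∧ IsTrade signs P d

open Classical in
/-- The connected cluster of peer `i` in the graph of successfully traded peers. -/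
def cluster (signs : Prop) (P : G.Dart → ℝ) (i : V) : Finset V :=
  Finset.univ.filter fun j => (tradeGraph signs P).Reachable i j

/-- The graph of successfully traded peers is connected. -/
def TradersConnected (signs : Prop) (P : G.Dart → ℝ) : Prop :=
  ∀ i j, IsTrader P i → IsTrader P j → (tradeGraph signs P).Reachable i j

namespace Market

variable (M : Market G)

/-- The price `(∑ b_j / (2 a_j)) / (∑ 1 / (2 a_j))`, with sums over the peers in `S`. -/
def commonPrice (S : Finset V) : ℝ :=
  (∑ j ∈ S, M.b j / (2 * M.a j)) / (∑ j ∈ S, 1 / (2 * M.a j))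

/-- The total power `(∑ b_j / (2 a_j)) / (2 a_i ∑ 1 / (2 a_j)) - b_i / (2 a_i)`, with sums over
the peers in `S`. -/
def commonPower (S : Finset V) (i : V) : ℝ :=
  (∑ j ∈ S, M.b j / (2 * M.a j)) / (2 * M.a i * ∑ j ∈ S, 1 / (2 * M.a j))
    - M.b i / (2 * M.a i)

/-- The linear system `[E, α]ᵀ (2 a_i p_i)_i = [(b_j + d_ji - b_i - d_ij), 0]` for the total powers
`p_i` of the successfully traded peers, written row by row: one equation for each edge `ij`
of the graph of successfully traded peers (the same one for both orientations), and the
zero-sum condition. -/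
def SolvesPowerSystem (signs : Prop) (P : G.Dart → ℝ) (p : V → ℝ) : Prop :=
  (∀ d : G.Dart, IsTrade signs P d →
    2 * M.a d.fst * p d.fst - 2 * M.a d.snd * p d.snd
      = M.b d.snd + M.w d.symm - M.b d.fst - M.w d) ∧
  ∑ i ∈ traders P, 1 / (2 * M.a i) * (2 * M.a i * p i) = 0

end Market

end

end

/-! The `P`-update minimizes a strongly convex quadratic over the antisymmetric vectors, so its
solutions are the balanced points with symmetric gradient (`isArgmin_objP_iff`), and the value of
the gradient on a pair is its multiplier. Solving for one pair expresses its power through the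
scaled row sums; summing over neighbours turns this into a Laplacian system whose matrix is positive
definite.

For the limit, the constraints are polyhedral, so Farkas' lemma yields a dual solution at the
optimum `Ps` without any constraint qualification. The weighted squared distance to this saddle
point drops at each step by a sum of nonnegative terms (`lyapunov_descent`), which must all tend to
zero: the increments of `P` and `X`, the error of the row sums, and the slack of `Ps` in the
variational inequality of the `X`-update. The row sums thus converge although nothing is claimed
about the individual trades. The price is the marginal cost plus multiples of the increments minus
one entry of the `X`-gradient. On a trade, `Ps` can be moved both ways in that entry inside the
inequality set (`exists_perturbation`), so the slack controls it. For each `ρ ≤ 1` the limits in `k`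
are therefore already the optimal values.

The same perturbation forces the dual solution to vanish on trades, so marginal costs agree at both
ends; since powers sum to zero over each cluster, the explicit formulas follow. -/

set_option linter.unusedSectionVars false

/-! ### Farkas' lemma, polyhedral multipliers, first-order conditions -/

/-- **Farkas' lemma**: a linear functional that is nonnegative wherever finitely many given ones
are is a nonnegative combination of them. -/
theorem LinearMap.exists_nonneg_combination {ι E : Type*} [AddCommGroup E]
    [Module ℝ E] (s : Finset ι) (a : ι → E →ₗ[ℝ] ℝ) (c : E →ₗ[ℝ] ℝ)
    (h : ∀ x, (∀ i ∈ s, 0 ≤ a i x) → 0 ≤ c x) :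
    ∃ t : ι → ℝ, (∀ i, 0 ≤ t i) ∧ c = ∑ i ∈ s, t i • a i := by
  classical
  induction s using Finset.induction_on generalizing a c with
  | empty =>
    refine ⟨0, by simp, ?_⟩
    ext x
    have h1 := h x (by simp)
    have h2 := h (-x) (by simp)
    simp only [map_neg] at h2
    simp only [Finset.sum_empty, LinearMap.zero_apply]
    linarith
  | insert j s hj ih =>
    by_cases hc : ∀ x, (∀ i ∈ s, 0 ≤ a i x) → 0 ≤ c x
    · obtain ⟨t, ht, hct⟩ := ih a c hc
      refine ⟨Function.update t j 0, fun i => ?_, ?_⟩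
      · by_cases hij : i = j
        · subst hij; simp
        · simpa [hij] using ht i
      · rw [Finset.sum_insert hj, hct]
        simp only [Function.update_self, zero_smul, zero_add]
        refine Finset.sum_congr rfl fun i hi => ?_
        rw [Function.update_of_ne (ne_of_mem_of_not_mem hi hj)]
    -- Here `x` violates only the new constraint; all functionals are projected along `x` onto the
    -- kernel of `a j`, where the induction hypothesis applies.
    · push Not at hc
      obtain ⟨x, hx, hcx⟩ := hc
      have hjx : a j x < 0 := by
        by_contra hn
        refine absurd (h x fun i hi => ?_) (not_le.2 hcx)
        rcases Finset.mem_insert.1 hi with rfl | hi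
        · exact not_lt.1 hn
        · exact hx i hi
      let r : (E →ₗ[ℝ] ℝ) → (E →ₗ[ℝ] ℝ) := fun g => g - (g x / a j x) • a j
      have hr : ∀ g z, r g z = g (z - (a j z / a j x) • x) := fun g z => by
        simp only [r, LinearMap.sub_apply, LinearMap.smul_apply, map_sub, map_smul, smul_eq_mul]
        ring
      obtain ⟨t, ht, hct⟩ := ih (fun i => r (a i)) (r c) fun z hz => by
        rw [hr]
        refine h _ fun i hi => ?_
        rcases Finset.mem_insert.1 hi with rfl | hi
        · simp [hjx.ne]
        · rw [← hr]; exact hz i hi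
      -- The coefficient of `a j` collects the projection corrections. It is nonnegative because `c
      -- x` and `a j x` are negative while the other `a i x` are nonnegative.
      refine ⟨Function.update t j (c x / a j x - ∑ i ∈ s, t i * (a i x / a j x)),
        fun i => ?_, ?_⟩
      · by_cases hij : i = j
        · subst hij
          simp only [Function.update_self]
          have h1 : 0 ≤ c x / a i x := div_nonneg_of_nonpos hcx.le hjx.le
          have h2 : ∑ k ∈ s, t k * (a k x / a i x) ≤ 0 := Finset.sum_nonpos fun k hk =>
            mul_nonpos_of_nonneg_of_nonpos (ht k) (div_nonpos_of_nonneg_of_nonpos (hx k hk) hjx.le)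
          linarith
        · simpa [hij] using ht i
      · ext z
        have hz := LinearMap.congr_fun hct z
        simp only [r, LinearMap.sub_apply, LinearMap.smul_apply, LinearMap.sum_apply,
          smul_eq_mul, mul_sub, Finset.sum_sub_distrib] at hz
        rw [Finset.sum_insert hj]
        have hs : ∑ i ∈ s, Function.update t j
            (c x / a j x - ∑ i ∈ s, t i * (a i x / a j x)) i • a i = ∑ i ∈ s, t i • a i :=
          Finset.sum_congr rfl fun i hi => by
            rw [Function.update_of_ne (ne_of_mem_of_not_mem hi hj)]
        rw [hs]
        simp only [Function.update_self, LinearMap.add_apply, LinearMap.smul_apply,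
          LinearMap.sum_apply, smul_eq_mul, sub_mul, Finset.sum_mul, mul_assoc] at hz ⊢
        linarith

/-- Existence of multipliers for finitely many linear inequality constraints on a subspace: a
linear functional that is minimal at `P` over the feasible points of the range of `A` splits into
one vanishing there and one supporting the inequality constraints at `P`. -/
theorem LinearMap.exists_multiplier_of_polyhedral {ι E F : Type*} [Finite ι] [AddCommGroup E]
    [Module ℝ E] [AddCommGroup F] [Module ℝ F] (A : F →ₗ[ℝ] E) (a : ι → E →ₗ[ℝ] ℝ) (c : ι → ℝ)
    (g : E →ₗ[ℝ] ℝ) (P : E) (hP : ∀ i, a i P ≤ c i)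
    (h : ∀ z, (∀ i, a i (P + A z) ≤ c i) → 0 ≤ g (A z)) :
    ∃ y : E →ₗ[ℝ] ℝ, (∀ z, g (A z) + y (A z) = 0) ∧
      ∀ Z, (∀ i, a i Z ≤ c i) → y (Z - P) ≤ 0 := by
  classical
  cases nonempty_fintype ι
  -- Only the constraints active at `P` enter: the inactive ones survive a sufficiently short step,
  -- so a direction admissible for the active ones is feasible.
  obtain ⟨t, ht, hg⟩ := LinearMap.exists_nonneg_combination
    (Finset.univ.filter fun i => a i P = c i) (fun i => -(a i ∘ₗ A)) (g ∘ₗ A) fun z hz => by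
      have hev : ∀ᶠ s : ℝ in 𝓝[>] 0, ∀ i, a i (P + A (s • z)) ≤ c i := by
        refine eventually_all.2 fun i => ?_
        simp only [map_add, map_smul, smul_eq_mul]
        by_cases hi : a i P = c i
        · have h1 := hz i (by simp [hi])
          simp only [LinearMap.neg_apply, LinearMap.comp_apply] at h1
          filter_upwards [self_mem_nhdsWithin] with s hs
          have : s * a i (A z) ≤ 0 :=
            mul_nonpos_of_nonneg_of_nonpos (le_of_lt hs) (by linarith)
          linarith
        · have hcont : ContinuousAt (fun s : ℝ => a i P + s * a i (A z)) 0 := by fun_prop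
          have := hcont.eventually_lt (continuousAt_const (y := c i))
            (by simpa using lt_of_le_of_ne (hP i) hi)
          filter_upwards [nhdsWithin_le_nhds this] with s hs using hs.le
      obtain ⟨s, hs, hs0⟩ := (hev.and self_mem_nhdsWithin).exists
      have := h _ hs
      simp only [map_smul, smul_eq_mul] at this
      exact nonneg_of_mul_nonneg_right this hs0
  refine ⟨∑ i with a i P = c i, t i • a i, fun z => ?_, fun Z hZ => ?_⟩
  · have := LinearMap.congr_fun hg z
    simp only [LinearMap.comp_apply, LinearMap.sum_apply, LinearMap.smul_apply,
      LinearMap.neg_apply, smul_eq_mul, mul_neg, Finset.sum_neg_distrib] at this ⊢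
    linarith
  · simp only [LinearMap.sum_apply, LinearMap.smul_apply, smul_eq_mul]
    refine Finset.sum_nonpos fun i hi => mul_nonpos_of_nonneg_of_nonpos (ht i) ?_
    have := hZ i
    have := (Finset.mem_filter.1 hi).2
    rw [map_sub]
    linarith

/-- Along the segment towards `z` the objective is exactly quadratic in `t`: divide the increment by
`t` and let `t` decrease to zero. -/
theorem IsArgmin.variation_nonneg {E : Type*} [AddCommGroup E] [Module ℝ E] {F : E → ℝ}
    {s : Set E} {x : E} (hx : IsArgmin F s x) (hs : Convex ℝ s) {z : E} (hz : z ∈ s) {g q : ℝ}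
    (hF : ∀ t : ℝ, F (x + t • (z - x)) = F x + t * g + t ^ 2 * q) : 0 ≤ g := by
  have hev : ∀ᶠ t : ℝ in 𝓝[>] 0, 0 ≤ g + t * q := by
    filter_upwards [Ioc_mem_nhdsGT one_pos] with t ht
    have h1 : F x ≤ F (x + t • (z - x)) :=
      hx.2 (hs.add_smul_sub_mem hx.1 hz ⟨ht.1.le, ht.2⟩)
    rw [hF] at h1
    have : 0 ≤ t * (g + t * q) := by linarith
    exact nonneg_of_mul_nonneg_right this ht.1
  have ht : Tendsto (fun t : ℝ => g + t * q) (𝓝[>] 0) (𝓝 (g + 0 * q)) :=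
    (Continuous.tendsto (by fun_prop) 0).mono_left nhdsWithin_le_nhds
  simpa using ge_of_tendsto ht hev

/-! ### Vectors on darts and expansions of the objectives -/

section

variable {V : Type*} [Fintype V] [DecidableEq V] {G : SimpleGraph V} [DecidableRel G.Adj]

theorem dart_symm_fst (d : G.Dart) : d.symm.fst = d.snd := rfl

theorem dart_symm_snd (d : G.Dart) : d.symm.snd = d.fst := rfl

theorem rowSum_add (P Q : G.Dart → ℝ) (i : V) : rowSum (P + Q) i = rowSum P i + rowSum Q i :=
  Finset.sum_add_distrib

theorem rowSum_sub (P Q : G.Dart → ℝ) (i : V) : rowSum (P - Q) i = rowSum P i - rowSum Q i :=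
  Finset.sum_sub_distrib _ _

theorem rowSum_smul (t : ℝ) (P : G.Dart → ℝ) (i : V) : rowSum (t • P) i = t * rowSum P i :=
  (Finset.mul_sum _ _ _).symm

theorem sum_mul_rowSum (c : V → ℝ) (P : G.Dart → ℝ) :
    ∑ i, c i * rowSum P i = ∑ d : G.Dart, c d.fst * P d := by
  rw [← Finset.sum_fiberwise_of_maps_to (g := fun d : G.Dart => d.fst)
    (fun _ _ => Finset.mem_univ _)]
  refine Finset.sum_congr rfl fun i _ => ?_
  rw [rowSum, Finset.mul_sum]
  exact Finset.sum_congr rfl fun d hd => by rw [(Finset.mem_filter.1 hd).2]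

theorem sum_rowSum (P : G.Dart → ℝ) : ∑ i, rowSum P i = ∑ d : G.Dart, P d := by
  simpa using sum_mul_rowSum (fun _ => 1) P

theorem sum_dart_symm (f : G.Dart → ℝ) : ∑ d : G.Dart, f d.symm = ∑ d, f d :=
  Equiv.sum_comp (SimpleGraph.Dart.symm_involutive.toPerm) f

theorem sqNorm_nonneg (P : G.Dart → ℝ) : 0 ≤ sqNorm P :=
  Finset.sum_nonneg fun _ _ => sq_nonneg _

theorem sq_le_sqNorm (P : G.Dart → ℝ) (d : G.Dart) : P d ^ 2 ≤ sqNorm P :=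
  Finset.single_le_sum (f := fun d => P d ^ 2) (fun _ _ => sq_nonneg _) (Finset.mem_univ d)

theorem sqNorm_smul (t : ℝ) (P : G.Dart → ℝ) : sqNorm (t • P) = t ^ 2 * sqNorm P := by
  simp only [sqNorm, Pi.smul_apply, smul_eq_mul, mul_pow, Finset.mul_sum]

theorem convex_balanceSet : Convex ℝ (balanceSet G) := by
  intro P hP Q hQ s t _ _ _ d
  have h1 := hP d
  have h2 := hQ d
  simp only [Pi.add_apply, Pi.smul_apply, smul_eq_mul]
  linear_combination s * h1 + t * h2

namespace Market

variable (M : Market G)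

theorem convex_ineqSet (signs : Prop) : Convex ℝ (M.ineqSet signs) := by
  intro P hP Q hQ s t hs ht hst
  refine ⟨fun i => ?_, fun h d => ⟨fun hb => ?_, fun hb => ?_⟩⟩
  · obtain ⟨h1, h2⟩ := hP.1 i
    obtain ⟨h3, h4⟩ := hQ.1 i
    obtain rfl : t = 1 - s := by linarith
    rw [rowSum_add, rowSum_smul, rowSum_smul]
    constructor <;> nlinarith
  · exact add_nonneg (mul_nonneg hs ((hP.2 h d).1 hb)) (mul_nonneg ht ((hQ.2 h d).1 hb))
  · exact add_nonpos (mul_nonpos_of_nonneg_of_nonpos hs ((hP.2 h d).2 hb))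
      (mul_nonpos_of_nonneg_of_nonpos ht ((hQ.2 h d).2 hb))

/-- The quadratic part of the total cost. -/
def curvature (D : G.Dart → ℝ) : ℝ := ∑ i, M.a i * rowSum D i ^ 2

theorem curvature_nonneg (D : G.Dart → ℝ) : 0 ≤ M.curvature D :=
  Finset.sum_nonneg fun i _ => mul_nonneg (M.a_pos i).le (sq_nonneg _)

theorem curvature_smul (t : ℝ) (D : G.Dart → ℝ) : M.curvature (t • D) = t ^ 2 * M.curvature D := by
  simp only [curvature, rowSum_smul, Finset.mul_sum]
  exact Finset.sum_congr rfl fun i _ => by ring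

theorem totalCost_eq (P : G.Dart → ℝ) :
    M.totalCost P = M.curvature P + ∑ d, (M.b d.fst + M.w d) * P d := by
  simp only [totalCost, cost, Finset.sum_add_distrib, curvature, sum_mul_rowSum, sum_rowSum,
    add_mul, add_assoc]

theorem totalCost_add (P D : G.Dart → ℝ) :
    M.totalCost (P + D) = M.totalCost P + ∑ d, M.marginal P d * D d + M.curvature D := by
  have h : ∑ d : G.Dart, M.marginal P d * D d
      = ∑ i, (2 * M.a i * rowSum P i) * rowSum D i + ∑ d, (M.b d.fst + M.w d) * D d := by
    rw [sum_mul_rowSum, ← Finset.sum_add_distrib]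
    exact Finset.sum_congr rfl fun d _ => by rw [marginal]; ring
  have h2 : M.curvature (P + D) = M.curvature P + ∑ i, (2 * M.a i * rowSum P i) * rowSum D i
      + M.curvature D := by
    simp only [curvature, ← Finset.sum_add_distrib, rowSum_add]
    exact Finset.sum_congr rfl fun i _ => by ring
  rw [h, totalCost_eq, totalCost_eq, h2]
  simp only [Pi.add_apply, mul_add, Finset.sum_add_distrib]
  ring

/-- The gradient of the objective of the `P`-update. -/
def gradP (ρ φ : ℝ) (Pk Xk uk P : G.Dart → ℝ) (d : G.Dart) : ℝ :=
  M.marginal P d + ρ * (P d - Xk d + uk d) + φ * (P d - Pk d)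

theorem gradP_eq (ρ φ : ℝ) (Pk Xk uk P : G.Dart → ℝ) (d : G.Dart) :
    M.gradP ρ φ Pk Xk uk P d
      = 2 * M.a d.fst * rowSum P d.fst + M.v ρ φ Pk Xk uk d + (ρ + φ) * P d := by
  rw [gradP, marginal, v]; ring

theorem objP_add (ρ φ : ℝ) (Pk Xk uk P D : G.Dart → ℝ) :
    M.objP ρ φ Pk Xk uk (P + D) = M.objP ρ φ Pk Xk uk P
      + ∑ d, M.gradP ρ φ Pk Xk uk P d * D d + (M.curvature D + (ρ + φ) / 2 * sqNorm D) := by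
  simp only [objP, totalCost_add, sqNorm, gradP, Finset.mul_sum, Pi.add_apply, Pi.sub_apply]
  have key : ∑ d, ρ / 2 * (P d + D d - Xk d + uk d) ^ 2 - ∑ d, ρ / 2 * (P d - Xk d + uk d) ^ 2
      + (∑ d, φ / 2 * (P d + D d - Pk d) ^ 2 - ∑ d, φ / 2 * (P d - Pk d) ^ 2)
      = ∑ d, (M.marginal P d + ρ * (P d - Xk d + uk d) + φ * (P d - Pk d)) * D d
        - ∑ d, M.marginal P d * D d + ∑ d, (ρ + φ) / 2 * D d ^ 2 := by
    simp only [← Finset.sum_add_distrib, ← Finset.sum_sub_distrib]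
    exact Finset.sum_congr rfl fun d _ => by ring
  linarith

end Market

/-- The gradient of the objective of the `X`-update. -/
def gradX (ρ ψ : ℝ) (Pk Xk uk X : G.Dart → ℝ) (d : G.Dart) : ℝ :=
  -(ρ * (Pk d - X d + uk d)) + ψ * (X d - Xk d)

theorem objX_add (ρ ψ : ℝ) (Pk Xk uk X D : G.Dart → ℝ) :
    objX ρ ψ Pk Xk uk (X + D) = objX ρ ψ Pk Xk uk X
      + ∑ d, gradX ρ ψ Pk Xk uk X d * D d + (ρ + ψ) / 2 * sqNorm D := by
  simp only [objX, sqNorm, gradX, Finset.mul_sum, Pi.add_apply, Pi.sub_apply,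
    ← Finset.sum_add_distrib]
  exact Finset.sum_congr rfl fun d _ => by ring

theorem sum_mul_smul (t : ℝ) (g D : G.Dart → ℝ) :
    ∑ d, g d * (t • D) d = t * ∑ d, g d * D d := by
  simp only [Pi.smul_apply, smul_eq_mul, Finset.mul_sum]
  exact Finset.sum_congr rfl fun d _ => by ring

theorem objX_variation_nonneg {M : Market G} {signs : Prop} {ρ ψ : ℝ}
    {Pk Xk uk X Z : G.Dart → ℝ} (hX : IsArgmin (objX ρ ψ Pk Xk uk) (M.ineqSet signs) X)
    (hZ : Z ∈ M.ineqSet signs) : 0 ≤ ∑ d, gradX ρ ψ Pk Xk uk X d * (Z d - X d) :=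
  hX.variation_nonneg (M.convex_ineqSet signs) hZ (q := (ρ + ψ) / 2 * sqNorm (Z - X)) fun t => by
    rw [objX_add, sum_mul_smul, sqNorm_smul]
    simp only [Pi.sub_apply]
    ring

theorem IsOptimal.variation_nonneg {M : Market G} {signs : Prop} {P Z : G.Dart → ℝ}
    (hP : M.IsOptimal signs P) (hZ : Z ∈ balanceSet G ∩ M.ineqSet signs) :
    0 ≤ ∑ d, M.marginal P d * (Z d - P d) :=
  IsArgmin.variation_nonneg hP (convex_balanceSet.inter (M.convex_ineqSet signs)) hZ
    (q := M.curvature (Z - P)) fun t => by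
      rw [M.totalCost_add, sum_mul_smul, M.curvature_smul]
      simp only [Pi.sub_apply]

theorem sum_mul_eq_zero_of_symm {g D : G.Dart → ℝ} (hg : ∀ d, g d = g d.symm)
    (hD : D ∈ balanceSet G) : ∑ d, g d * D d = 0 := by
  have h := sum_dart_symm fun d => g d * D d
  have h2 : ∑ d, (g d * D d + g d.symm * D d.symm) = 0 :=
    Finset.sum_eq_zero fun d _ => by
      rw [← hg d]; linear_combination g d * hD d
  rw [Finset.sum_add_distrib] at h2
  linarith

/-- The vector `P` with the entry at `d` raised by `t`. -/
theorem update_eq_add_single (P : G.Dart → ℝ) (d : G.Dart) (t : ℝ) :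
    Function.update P d t = P + (t - P d) • Pi.single d 1 := by
  ext e
  by_cases h : e = d
  · subst h; simp
  · simp [h]

theorem sum_mul_single (g : G.Dart → ℝ) (d : G.Dart) :
    ∑ e, g e * (Pi.single d (1 : ℝ) : G.Dart → ℝ) e = g d := by
  simp [Pi.single_apply]

theorem single_sub_single_symm_mem (d : G.Dart) :
    (Pi.single d 1 - Pi.single d.symm 1 : G.Dart → ℝ) ∈ balanceSet G := by
  intro e
  have h1 : (e.symm = d) ↔ (e = d.symm) := SimpleGraph.Dart.symm_involutive.eq_iff
  have h2 : (e.symm = d.symm) ↔ (e = d) := SimpleGraph.Dart.symm_involutive.injective.eq_iff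
  simp only [Pi.sub_apply, Pi.single_apply, h1, h2]
  ring

/-- Converse of `sum_mul_eq_zero_of_symm`: test against the elementary exchange along `d`. So the
orthogonal complement of the balance set consists of the symmetric vectors. -/
theorem symm_of_forall_sum_mul_eq_zero {g : G.Dart → ℝ}
    (hg : ∀ D ∈ balanceSet G, ∑ d, g d * D d = 0) (d : G.Dart) : g d = g d.symm := by
  have := hg _ (single_sub_single_symm_mem d)
  simp only [Pi.sub_apply, mul_sub, Finset.sum_sub_distrib, sum_mul_single] at this
  linarith

/-! ### The `P`-update: optimality, prices and the Laplacian system -/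

namespace Market

variable (M : Market G)

/-- Optimality in the `P`-update: the gradient is symmetric. -/
theorem isArgmin_objP_iff {ρ φ : ℝ} (hρ : 0 < ρ) (hφ : 0 < φ) (Pk Xk uk P : G.Dart → ℝ) :
    IsArgmin (M.objP ρ φ Pk Xk uk) (balanceSet G) P ↔ P ∈ balanceSet G ∧
      ∀ d, M.gradP ρ φ Pk Xk uk P d = M.gradP ρ φ Pk Xk uk P d.symm := by
  have hbal : ∀ {P D : G.Dart → ℝ} (t : ℝ), P ∈ balanceSet G → D ∈ balanceSet G →
      P + t • D ∈ balanceSet G := fun t hP hD d => by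
    simp only [Pi.add_apply, Pi.smul_apply, smul_eq_mul]
    linear_combination hP d + t * hD d
  constructor
  · intro h
    refine ⟨h.1, symm_of_forall_sum_mul_eq_zero fun D hD => ?_⟩
    have key : ∀ s : ℝ, 0 ≤ s * ∑ d, M.gradP ρ φ Pk Xk uk P d * D d := fun s =>
      h.variation_nonneg convex_balanceSet (hbal s h.1 hD)
        (q := M.curvature (s • D) + (ρ + φ) / 2 * sqNorm (s • D)) fun t => by
          rw [add_sub_cancel_left, objP_add, sum_mul_smul, sum_mul_smul, curvature_smul,
            sqNorm_smul]
          ring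
    linarith [key 1, key (-1)]
  · rintro ⟨hP, hg⟩
    refine ⟨hP, fun Q hQ => ?_⟩
    have hD : Q - P ∈ balanceSet G := by
      have := hbal (-1) hQ hP
      rwa [neg_one_smul, ← sub_eq_add_neg] at this
    have := M.objP_add ρ φ Pk Xk uk P (Q - P)
    rw [add_sub_cancel, sum_mul_eq_zero_of_symm hg hD] at this
    have h1 := M.curvature_nonneg (Q - P)
    have h2 := mul_nonneg (by positivity : 0 ≤ (ρ + φ) / 2) (sqNorm_nonneg (Q - P))
    show M.objP ρ φ Pk Xk uk P ≤ M.objP ρ φ Pk Xk uk Q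
    linarith

theorem hasDerivAt_objP (ρ φ : ℝ) (Pk Xk uk P : G.Dart → ℝ) (d : G.Dart) :
    HasDerivAt (fun t => M.objP ρ φ Pk Xk uk (Function.update P d t))
      (M.gradP ρ φ Pk Xk uk P d) (P d) := by
  simp only [update_eq_add_single, objP_add, sum_mul_smul, sum_mul_single, curvature_smul,
    sqNorm_smul]
  have h1 : HasDerivAt (fun t : ℝ => t - P d) 1 (P d) := (hasDerivAt_id _).sub_const _
  have h2 := ((h1.mul_const (M.gradP ρ φ Pk Xk uk P d)).const_add
    (M.objP ρ φ Pk Xk uk P)).add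
      (((h1.pow 2).mul_const (M.curvature (Pi.single d 1))).add
        (((h1.pow 2).mul_const (sqNorm (Pi.single d 1))).const_mul ((ρ + φ) / 2)))
  exact h2.congr_deriv (by simp)

/-- Partial derivatives are unique, so the only candidate is the gradient, and its symmetry is the
sole condition for existence. -/
theorem isMultiplier_objP_iff (ρ φ : ℝ) (Pk Xk uk P lam : G.Dart → ℝ) :
    IsMultiplier (M.objP ρ φ Pk Xk uk) P lam ↔
      (∀ d, M.gradP ρ φ Pk Xk uk P d = M.gradP ρ φ Pk Xk uk P d.symm) ∧
        ∀ d, lam d = M.gradP ρ φ Pk Xk uk P d := by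
  constructor
  · intro h
    have h2 : ∀ d, lam d = M.gradP ρ φ Pk Xk uk P d :=
      fun d => (h d).2.unique (M.hasDerivAt_objP ρ φ Pk Xk uk P d)
    exact ⟨fun d => by rw [← h2, ← h2]; exact (h d).1, h2⟩
  · rintro ⟨h1, h2⟩ d
    rw [h2, h2]
    exact ⟨h1 d, M.hasDerivAt_objP ρ φ Pk Xk uk P d⟩

end Market

theorem rowSum_sub_snd (y : V → ℝ) (i : V) :
    rowSum (fun d : G.Dart => y d.fst - y d.snd) i = (G.lapMatrix ℝ *ᵥ y) i := by
  rw [rowSum, SimpleGraph.lapMatrix_mulVec_apply, Finset.sum_sub_distrib]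
  congr 1
  · rw [Finset.sum_congr rfl fun d hd => by rw [(Finset.mem_filter.1 hd).2], Finset.sum_const,
      G.dart_fst_fiber_card_eq_degree, nsmul_eq_mul]
  · refine Finset.sum_bij' (fun d _ => d.snd) (fun j hj => ⟨(i, j), (G.mem_neighborFinset i j).1 hj⟩)
      (fun d hd => ?_) (fun j hj => ?_) (fun d hd => ?_) (fun j hj => rfl) (fun d hd => rfl)
    · rw [SimpleGraph.mem_neighborFinset, ← (Finset.mem_filter.1 hd).2]
      exact d.adj
    · simp
    · ext
      · exact (Finset.mem_filter.1 hd).2.symm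
      · rfl

namespace Market

variable (M : Market G)

theorem posDef_lapMatrix_add_Gam {ρ φ : ℝ} (hρ : 0 < ρ) (hφ : 0 < φ) :
    (G.lapMatrix ℝ + M.Gam ρ φ).PosDef := by
  refine Matrix.PosDef.posSemidef_add (G.posSemidef_lapMatrix ℝ) ?_
  rw [Gam, ← Matrix.diagonal_smul]
  refine Matrix.PosDef.diagonal fun i => ?_
  have := M.a_pos i
  simp only [Pi.smul_apply, smul_eq_mul]
  positivity

theorem lapMatrix_add_Gam_mulVec (ρ φ : ℝ) (y : V → ℝ) (i : V) :
    ((G.lapMatrix ℝ + M.Gam ρ φ) *ᵥ y) i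
      = (G.lapMatrix ℝ *ᵥ y) i + (ρ + φ) * (1 / M.a i) * y i := by
  rw [Matrix.add_mulVec, Pi.add_apply, Gam, Matrix.smul_mulVec, Pi.smul_apply,
    Matrix.mulVec_diagonal, smul_eq_mul, mul_assoc]

theorem mulVec_injective_lapMatrix_add_Gam {ρ φ : ℝ} (hρ : 0 < ρ) (hφ : 0 < φ) :
    Function.Injective ((G.lapMatrix ℝ + M.Gam ρ φ) *ᵥ ·) :=
  Matrix.mulVec_injective_iff_isUnit.2 (M.posDef_lapMatrix_add_Gam hρ hφ).isUnit

theorem mulVec_surjective_lapMatrix_add_Gam {ρ φ : ℝ} (hρ : 0 < ρ) (hφ : 0 < φ) :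
    Function.Surjective ((G.lapMatrix ℝ + M.Gam ρ φ) *ᵥ ·) :=
  Matrix.mulVec_surjective_iff_isUnit.2 (M.posDef_lapMatrix_add_Gam hρ hφ).isUnit

/-- The trades with the scaled total powers `y`, in closed form. -/
noncomputable def updateP (ρ φ : ℝ) (Pk Xk uk : G.Dart → ℝ) (y : V → ℝ) (d : G.Dart) : ℝ :=
  (M.v ρ φ Pk Xk uk d.symm + y d.snd - M.v ρ φ Pk Xk uk d - y d.fst) / (2 * (ρ + φ))

theorem rowSum_updateP {ρ φ : ℝ} (hρ : 0 < ρ) (hφ : 0 < φ) (Pk Xk uk : G.Dart → ℝ) (y : V → ℝ)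
    (i : V) : 2 * (ρ + φ) * rowSum (M.updateP ρ φ Pk Xk uk y) i
      = rowSum (fun d => M.v ρ φ Pk Xk uk d.symm) i - rowSum (M.v ρ φ Pk Xk uk) i
        - (G.lapMatrix ℝ *ᵥ y) i := by
  rw [← rowSum_sub_snd, ← rowSum_sub, ← rowSum_sub, ← rowSum_smul]
  congr 1
  ext d
  have : ρ + φ ≠ 0 := by positivity
  simp only [updateP, Pi.smul_apply, Pi.sub_apply, smul_eq_mul]
  field_simp
  ring

/-- The linear system for `y` says that `y` are the scaled total powers of the trades it gives. -/
theorem lapMatrix_add_Gam_mulVec_eq_iff {ρ φ : ℝ} (hρ : 0 < ρ) (hφ : 0 < φ)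
    (Pk Xk uk : G.Dart → ℝ) (y : V → ℝ) :
    (G.lapMatrix ℝ + M.Gam ρ φ) *ᵥ y
        = (fun i => rowSum (fun d => M.v ρ φ Pk Xk uk d.symm) i)
          - (fun i => rowSum (M.v ρ φ Pk Xk uk) i)
      ↔ ∀ i, y i = 2 * M.a i * rowSum (M.updateP ρ φ Pk Xk uk y) i := by
  rw [funext_iff]
  refine forall_congr' fun i => ?_
  have h := M.rowSum_updateP hρ hφ Pk Xk uk y i
  have ha := M.a_pos i
  have h1 : 0 < ρ + φ := by positivity
  rw [lapMatrix_add_Gam_mulVec, Pi.sub_apply]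
  generalize rowSum (M.updateP ρ φ Pk Xk uk y) i = R at *
  have e : (ρ + φ) * (1 / M.a i) * y i = 2 * (ρ + φ) * R ↔ y i = 2 * M.a i * R := by
    rw [mul_one_div, div_mul_eq_mul_div, div_eq_iff ha.ne']
    constructor
    · intro h2
      exact mul_left_cancel₀ h1.ne' (by linear_combination h2)
    · intro h2
      linear_combination (ρ + φ) * h2
  rw [← e]
  constructor <;> intro h2 <;> linarith

/-- Balance and symmetry of the gradient are two linear equations per pair, equivalent to the closed
form; balance is recovered because the closed form is antisymmetric. -/
theorem isArgmin_objP_iff_eq_updateP {ρ φ : ℝ} (hρ : 0 < ρ) (hφ : 0 < φ)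
    (Pk Xk uk P : G.Dart → ℝ) : IsArgmin (M.objP ρ φ Pk Xk uk) (balanceSet G) P ↔
      P = M.updateP ρ φ Pk Xk uk fun i => 2 * M.a i * rowSum P i := by
  have h1 : ρ + φ ≠ 0 := by positivity
  rw [isArgmin_objP_iff M hρ hφ, funext_iff]
  simp only [updateP, gradP_eq, eq_div_iff (mul_ne_zero two_ne_zero h1)]
  constructor
  · rintro ⟨hP, hg⟩ d
    have := hg d
    simp only [dart_symm_fst] at this
    linear_combination this + (ρ + φ) * hP d
  · intro h
    have hb : P ∈ balanceSet G := fun d => by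
      have h2 := h d
      have h3 := h d.symm
      simp only [SimpleGraph.Dart.symm_symm, dart_symm_fst,
        dart_symm_snd] at h3
      exact mul_right_cancel₀ (mul_ne_zero two_ne_zero h1) (by linear_combination h2 + h3)
    refine ⟨hb, fun d => ?_⟩
    simp only [dart_symm_fst]
    linear_combination h d - (ρ + φ) * hb d

theorem existsUnique_isArgmin_objP {ρ φ : ℝ} (hρ : 0 < ρ) (hφ : 0 < φ)
    (Pk Xk uk : G.Dart → ℝ) :
    ∃! P, IsArgmin (M.objP ρ φ Pk Xk uk) (balanceSet G) P := by
  simp only [isArgmin_objP_iff_eq_updateP M hρ hφ]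
  obtain ⟨y, hy⟩ := M.mulVec_surjective_lapMatrix_add_Gam hρ hφ
    ((fun i => rowSum (fun d => M.v ρ φ Pk Xk uk d.symm) i)
      - (fun i => rowSum (M.v ρ φ Pk Xk uk) i))
  have hy' := (M.lapMatrix_add_Gam_mulVec_eq_iff hρ hφ Pk Xk uk y).1 hy
  -- The closed form at the solution `y` has `y` as its scaled row sums, hence is a fixed point; any
  -- other fixed point has scaled row sums solving the same nonsingular system.
  refine ⟨M.updateP ρ φ Pk Xk uk y, ?_, fun Q hQ => ?_⟩
  · show _ = M.updateP ρ φ Pk Xk uk _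
    rw [← funext hy']
  · have hz := (M.lapMatrix_add_Gam_mulVec_eq_iff hρ hφ Pk Xk uk
      fun i => 2 * M.a i * rowSum Q i).2 fun i => by rw [← hQ]
    have := M.mulVec_injective_lapMatrix_add_Gam hρ hφ (hz.trans hy.symm)
    rw [hQ, this]

theorem lapMatrix_add_Gam_mulVec_eq_iff_of_isArgmin {ρ φ : ℝ} (hρ : 0 < ρ) (hφ : 0 < φ)
    {Pk Xk uk P : G.Dart → ℝ} (hP : IsArgmin (M.objP ρ φ Pk Xk uk) (balanceSet G) P)
    (y : V → ℝ) :
    (G.lapMatrix ℝ + M.Gam ρ φ) *ᵥ y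
        = (fun i => rowSum (fun d => M.v ρ φ Pk Xk uk d.symm) i)
          - (fun i => rowSum (M.v ρ φ Pk Xk uk) i)
      ↔ y = fun i => 2 * M.a i * rowSum P i := by
  have hP' := (M.isArgmin_objP_iff_eq_updateP hρ hφ Pk Xk uk P).1 hP
  have hz := (M.lapMatrix_add_Gam_mulVec_eq_iff hρ hφ Pk Xk uk
    fun i => 2 * M.a i * rowSum P i).2 fun i => by rw [← hP']
  rw [← hz]
  exact (M.mulVec_injective_lapMatrix_add_Gam hρ hφ).eq_iff

theorem gradP_eq_of_isArgmin {ρ φ : ℝ} (hρ : 0 < ρ) (hφ : 0 < φ) {Pk Xk uk P : G.Dart → ℝ}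
    (hP : IsArgmin (M.objP ρ φ Pk Xk uk) (balanceSet G) P) (d : G.Dart) :
    M.gradP ρ φ Pk Xk uk P d = (M.v ρ φ Pk Xk uk d.symm + 2 * M.a d.snd * rowSum P d.snd
      + M.v ρ φ Pk Xk uk d + 2 * M.a d.fst * rowSum P d.fst) / 2 := by
  obtain ⟨hb, hg⟩ := (M.isArgmin_objP_iff hρ hφ Pk Xk uk P).1 hP
  have h := hg d
  have h2 := hb d
  simp only [gradP_eq, dart_symm_fst] at h ⊢
  linear_combination (1 / 2) * h + (ρ + φ) / 2 * h2

end Market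
end

/-! ### Descent sequences and the one-coordinate inequality -/

/-- A decreasing sequence bounded below converges, so its successive drops, which dominate `w`, tend
to zero. -/
theorem tendsto_zero_of_descent {v w : ℕ → ℝ} (hv : ∀ k, 0 ≤ v k) (hw : ∀ k, 0 ≤ w k)
    (h : ∀ k, v (k + 1) + w k ≤ v k) : Tendsto w atTop (𝓝 0) := by
  have hanti : Antitone v := antitone_nat_of_succ_le fun k => by linarith [h k, hw k]
  have hlim := tendsto_atTop_ciInf hanti ⟨0, by rintro _ ⟨k, rfl⟩; exact hv k⟩
  have hdiff := hlim.sub (hlim.comp (tendsto_add_atTop_nat 1))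
  rw [sub_self] at hdiff
  exact squeeze_zero hw (fun k => by have := h k; simp only [Function.comp_apply]; linarith) hdiff

theorem tendsto_zero_of_sq_le {f w : ℕ → ℝ} {c : ℝ} (hc : 0 < c) (hw : Tendsto w atTop (𝓝 0))
    (h : ∀ k, c * f k ^ 2 ≤ w k) : Tendsto f atTop (𝓝 0) := by
  have h1 : Tendsto (fun k => √(w k / c)) atTop (𝓝 0) := by
    simpa using (hw.div_const c).sqrt
  refine squeeze_zero_norm (fun k => ?_) h1
  rw [Real.norm_eq_abs]
  exact Real.abs_le_sqrt (by rw [le_div_iff₀ hc]; linarith [h k])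

/-- One step of the proximal method in one coordinate: `p, x, y` are the new values, `p₀, x₀, y₀`
the old ones, and `s, s, η` the coordinates of a saddle point. -/
theorem prox_descent_coordinate {ρ φ ψ γ μ₁ μ₂ : ℝ} (hρ : 0 < ρ) (hγ : 0 < γ) (hμ₁ : 0 < μ₁)
    (hμ₂ : 0 < μ₂) (p p₀ x x₀ y₀ s η : ℝ) :
    (φ + ρ) * (p - s) ^ 2 + (ψ + ρ) * (x - s) ^ 2
        + 1 / (γ * ρ) * (y₀ + γ * ρ * (p - x) - η) ^ 2
        + ρ * (2 - γ - μ₁ - μ₂) * (p - x) ^ 2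
        + (φ + ρ - ρ * (1 / μ₁)) * (p - p₀) ^ 2
        + (ψ + ρ - ρ * (1 / μ₂)) * (x - x₀) ^ 2
      ≤ (φ + ρ) * (p₀ - s) ^ 2 + (ψ + ρ) * (x₀ - s) ^ 2 + 1 / (γ * ρ) * (y₀ - η) ^ 2
        + 2 * ((ρ * (p - x₀) + y₀ - η + φ * (p - p₀)) * (p - s)
          - (ρ * (p₀ - x) + y₀ - ψ * (x - x₀) - η) * (x - s)) := by
  -- Young's inequality for the products of the residual `p - x` with the two increments, in
  -- completed-square form; these squares are exactly what the estimate discards.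
  have h1 : 0 ≤ ρ * μ₁ * (p - x - (p - p₀) / μ₁) ^ 2 := by positivity
  have h2 : 0 ≤ ρ * μ₂ * (p - x + (x - x₀) / μ₂) ^ 2 := by positivity
  have e : (φ + ρ) * (p₀ - s) ^ 2 + (ψ + ρ) * (x₀ - s) ^ 2 + 1 / (γ * ρ) * (y₀ - η) ^ 2
        + 2 * ((ρ * (p - x₀) + y₀ - η + φ * (p - p₀)) * (p - s)
          - (ρ * (p₀ - x) + y₀ - ψ * (x - x₀) - η) * (x - s))
      - ((φ + ρ) * (p - s) ^ 2 + (ψ + ρ) * (x - s) ^ 2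
        + 1 / (γ * ρ) * (y₀ + γ * ρ * (p - x) - η) ^ 2
        + ρ * (2 - γ - μ₁ - μ₂) * (p - x) ^ 2
        + (φ + ρ - ρ * (1 / μ₁)) * (p - p₀) ^ 2
        + (ψ + ρ - ρ * (1 / μ₂)) * (x - x₀) ^ 2)
      = ρ * μ₁ * (p - x - (p - p₀) / μ₁) ^ 2 + ρ * μ₂ * (p - x + (x - x₀) / μ₂) ^ 2 := by
    field_simp
    ring
  linarith

/-! ### Dual solutions, perturbations and the Lyapunov function -/

section

variable {V : Type*} [Fintype V] [DecidableEq V] {G : SimpleGraph V} [DecidableRel G.Adj]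

namespace Market

variable (M : Market G)

/-- `y` is a dual solution at the primal point `P`: together they form a saddle point for the
consensus form of the trading problem. -/
structure IsDualSolution (signs : Prop) (P y : G.Dart → ℝ) : Prop where
  symm : ∀ d, M.marginal P d + y d = M.marginal P d.symm + y d.symm
  normal : ∀ Z ∈ M.ineqSet signs, ∑ d, y d * (Z d - P d) ≤ 0

/-- The vector of row sums as a family of linear functionals. -/
def rowSumLinear (i : V) : (G.Dart → ℝ) →ₗ[ℝ] ℝ where
  toFun P := rowSum P i
  map_add' P Q := rowSum_add P Q i
  map_smul' t P := rowSum_smul t P i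

open Classical in
/-- The linear constraints defining the inequality set. -/
noncomputable def constraint (signs : Prop) : V ⊕ V ⊕ G.Dart → (G.Dart → ℝ) →ₗ[ℝ] ℝ
  | .inl i => rowSumLinear i
  | .inr (.inl i) => -rowSumLinear i
  | .inr (.inr d) => if signs then
      if M.buyer d.fst then -LinearMap.proj d else LinearMap.proj d else 0

/-- The right-hand sides of the linear constraints. -/
def constraintBound : V ⊕ V ⊕ G.Dart → ℝ
  | .inl i => M.pmax i
  | .inr (.inl i) => -M.pmin i
  | .inr (.inr _) => 0

theorem mem_ineqSet_iff (signs : Prop) (X : G.Dart → ℝ) :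
    X ∈ M.ineqSet signs ↔ ∀ j, M.constraint signs j X ≤ M.constraintBound j := by
  simp only [Sum.forall, constraint, constraintBound, LinearMap.neg_apply, neg_le_neg_iff]
  rw [← and_assoc, ← forall_and]
  refine and_congr (forall_congr' fun i => and_comm) ?_
  by_cases hs : signs
  · simp only [hs, if_true, true_imp_iff]
    refine forall_congr' fun d => ?_
    by_cases hb : M.buyer d.fst <;> simp [hb]
  · simp [hs]

/-- The map `P_ij ↦ P_ij - P_ji` onto the balance set. -/
def antisymmetrize : (G.Dart → ℝ) →ₗ[ℝ] (G.Dart → ℝ) :=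
  LinearMap.id - LinearMap.funLeft ℝ ℝ SimpleGraph.Dart.symm

theorem antisymmetrize_apply (P : G.Dart → ℝ) (d : G.Dart) :
    antisymmetrize P d = P d - P d.symm := rfl

/-- The balance set is the range of `antisymmetrize` and the inequality set is polyhedral, so the
multiplier theorem applies to the gradient of the cost at `P`. -/
theorem IsOptimal.exists_isDualSolution {M : Market G} {signs : Prop} {P : G.Dart → ℝ}
    (hP : M.IsOptimal signs P) : ∃ y, M.IsDualSolution signs P y := by
  obtain ⟨f, hf, hn⟩ := LinearMap.exists_multiplier_of_polyhedral antisymmetrize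
    (M.constraint signs) M.constraintBound
    (∑ d, M.marginal P d • LinearMap.proj d) P ((M.mem_ineqSet_iff signs P).1 hP.1.2)
    fun z hz => by
      have hmem := (M.mem_ineqSet_iff signs _).2 hz
      have hbal : P + antisymmetrize z ∈ balanceSet G := fun d => by
        simp only [Pi.add_apply, antisymmetrize_apply, SimpleGraph.Dart.symm_symm]
        linear_combination hP.1.1 d
      simpa [LinearMap.sum_apply] using IsOptimal.variation_nonneg hP ⟨hbal, hmem⟩
  have hfy : ∀ Z, f Z = ∑ d, f (Pi.single d 1) * Z d := fun Z => by
    rw [LinearMap.pi_apply_eq_sum_univ f Z]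
    refine Finset.sum_congr rfl fun d _ => ?_
    rw [smul_eq_mul, mul_comm]
    congr 2
    ext e
    simp [Pi.single_apply, eq_comm]
  refine ⟨fun d => f (Pi.single d 1), symm_of_forall_sum_mul_eq_zero
    (g := fun d => M.marginal P d + f (Pi.single d 1)) fun D hD => ?_, fun Z hZ => ?_⟩
  -- A balanced vector is the antisymmetrization of its half.
  · have hA : antisymmetrize ((1 / 2 : ℝ) • D) = D := by
      ext d
      simp only [antisymmetrize_apply, Pi.smul_apply, smul_eq_mul]
      linear_combination (-1 / 2) * hD d
    have := hf ((1 / 2 : ℝ) • D)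
    rw [hA, hfy] at this
    simpa [LinearMap.sum_apply, add_mul, Finset.sum_add_distrib] using this
  · have := hn Z ((M.mem_ineqSet_iff signs Z).1 hZ)
    rw [hfy] at this
    simpa using this

theorem rowSum_single (d : G.Dart) (i : V) :
    rowSum (Pi.single d 1 : G.Dart → ℝ) i = if d.fst = i then 1 else 0 := by
  simp [rowSum, Pi.single_apply, Finset.sum_ite_eq']

/-- On a trade between successfully traded peers within their bounds, the power can be changed
slightly in both directions. -/
theorem exists_perturbation {M : Market G} {signs : Prop} {P : G.Dart → ℝ}
    (hP : P ∈ M.ineqSet signs)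
    (hint : ∀ i, IsTrader P i → M.pmin i < rowSum P i ∧ rowSum P i < M.pmax i)
    {d : G.Dart} (hd : IsTrade signs P d) :
    ∃ ε : ℝ, 0 < ε ∧ P + ε • Pi.single d (1 : ℝ) ∈ M.ineqSet signs ∧
      P + (-ε) • Pi.single d (1 : ℝ) ∈ M.ineqSet signs := by
  -- Changing one entry leaves the balance set, but only the inequality constraints count here. Just
  -- one row bound and one sign are affected, and both are strict on a trade.
  have hev : ∀ᶠ t : ℝ in 𝓝 0, P + t • Pi.single d (1 : ℝ) ∈ M.ineqSet signs := by
    have hcont : ∀ c r : ℝ, Tendsto (fun t : ℝ => c + t * r) (𝓝 0) (𝓝 c) := fun c r => by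
      have : Continuous fun t : ℝ => c + t * r := by fun_prop
      simpa using this.tendsto 0
    refine Filter.Eventually.and (eventually_all.2 fun i => ?_) ?_
    · simp only [rowSum_add, rowSum_smul, rowSum_single]
      by_cases hi : d.fst = i
      · subst hi
        obtain ⟨h1, h2⟩ := hint _ hd.1
        filter_upwards [(hcont _ _).eventually_const_lt h1, (hcont _ _).eventually_lt_const h2]
          with t ht1 ht2 using ⟨ht1.le, ht2.le⟩
      · simpa [hi] using hP.1 i
    · by_cases hs : signs
      · simp only [hs, true_imp_iff]
        refine eventually_all.2 fun e => ?_
        simp only [Pi.add_apply, Pi.smul_apply, smul_eq_mul]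
        obtain ⟨h1, h2⟩ := hP.2 hs e
        by_cases he : e = d
        · subst he
          have hne := hd.2.2 hs
          by_cases hb : M.buyer e.fst
          · filter_upwards [(hcont (P e) _).eventually_const_lt ((h1 hb).lt_of_ne' hne)]
              with t ht using ⟨fun _ => ht.le, fun h => absurd hb h⟩
          · filter_upwards [(hcont (P e) _).eventually_lt_const ((h2 hb).lt_of_ne hne)]
              with t ht using ⟨fun h => absurd h hb, fun _ => ht.le⟩
        · simpa [he] using ⟨h1, h2⟩
      · simp [hs]
  obtain ⟨ε, hε, h⟩ := Metric.eventually_nhds_iff.1 hev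
  refine ⟨ε / 2, by positivity, h ?_, h ?_⟩ <;>
    rw [Real.dist_eq, sub_zero, abs_lt] <;> constructor <;> linarith

theorem sum_mul_perturb_sub (g P X : G.Dart → ℝ) (t : ℝ) (d : G.Dart) :
    ∑ e, g e * ((P + t • Pi.single d (1 : ℝ) : G.Dart → ℝ) e - X e) = ∑ e, g e * (P e - X e) + t * g d := by
  rw [← sum_mul_single g d, ← sum_mul_smul, ← Finset.sum_add_distrib]
  exact Finset.sum_congr rfl fun e _ => by rw [Pi.add_apply]; ring

/-- Complementary slackness: the normal inequality tested at both perturbations bounds the entry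
from both sides. -/
theorem IsDualSolution.eq_zero {M : Market G} {signs : Prop} {P y : G.Dart → ℝ}
    (hy : M.IsDualSolution signs P y) (hP : P ∈ M.ineqSet signs)
    (hint : ∀ i, IsTrader P i → M.pmin i < rowSum P i ∧ rowSum P i < M.pmax i)
    {d : G.Dart} (hd : IsTrade signs P d) : y d = 0 := by
  obtain ⟨ε, hε, h1, h2⟩ := exists_perturbation hP hint hd
  have k1 := hy.normal _ h1
  have k2 := hy.normal _ h2
  simp only [sum_mul_perturb_sub, sub_self, mul_zero, Finset.sum_const_zero, zero_add] at k1 k2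
  have : ε * y d = 0 := by linarith
  exact (mul_eq_zero.1 this).resolve_left hε.ne'

theorem sum_marginal_sub (P Q : G.Dart → ℝ) :
    ∑ d, (M.marginal P d - M.marginal Q d) * (P d - Q d) = 2 * M.curvature (P - Q) := by
  rw [curvature, Finset.mul_sum]
  have := sum_mul_rowSum (fun i => 2 * M.a i * rowSum (P - Q) i) (P - Q)
  rw [Finset.sum_congr rfl fun i _ => show 2 * (M.a i * rowSum (P - Q) i ^ 2)
    = 2 * M.a i * rowSum (P - Q) i * rowSum (P - Q) i by ring, this]
  refine Finset.sum_congr rfl fun d _ => ?_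
  rw [marginal, marginal, rowSum_sub, Pi.sub_apply]
  ring

theorem sub_mem_balanceSet {P Q : G.Dart → ℝ} (hP : P ∈ balanceSet G) (hQ : Q ∈ balanceSet G) :
    P - Q ∈ balanceSet G := fun d => by
  simp only [Pi.sub_apply]
  linear_combination hP d - hQ d

/-- The weighted squared distance to a saddle point. -/
noncomputable def lyapunov (ρ φ ψ κ : ℝ) (Ps y P X u : G.Dart → ℝ) : ℝ :=
  ∑ d, ((φ + ρ) * (P d - Ps d) ^ 2 + (ψ + ρ) * (X d - Ps d) ^ 2
    + 1 / (κ * ρ * ρ) * (ρ * u d - y d) ^ 2)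

/-- After summing over coordinates, the cross term splits into a symmetric vector paired with a
balanced one (zero), the monotone marginal cost (the curvature), the slack of the `X`-update, and a
dual term that is nonpositive by normality. -/
theorem lyapunov_descent {M : Market G} {signs : Prop} {ρ φ ψ κ μ₁ μ₂ : ℝ} (hρ : 0 < ρ)
    (hφ : 0 < φ) (hκ : 0 < κ) (hμ₁ : 0 < μ₁) (hμ₂ : 0 < μ₂) {Ps y P₀ X₀ u₀ P X : G.Dart → ℝ}
    (hPs : Ps ∈ balanceSet G) (hy : M.IsDualSolution signs Ps y)
    (hX : X ∈ M.ineqSet signs)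
    (hP : IsArgmin (M.objP ρ φ P₀ X₀ u₀) (balanceSet G) P) :
    lyapunov ρ φ ψ κ Ps y P X (u₀ + (κ * ρ) • (P - X))
      + (ρ * (2 - κ * ρ - μ₁ - μ₂) * sqNorm (P - X)
        + (φ + ρ - ρ * (1 / μ₁)) * sqNorm (P - P₀)
        + (ψ + ρ - ρ * (1 / μ₂)) * sqNorm (X - X₀)
        + 4 * M.curvature (P - Ps)
        + 2 * ∑ d, gradX ρ ψ P₀ X₀ u₀ X d * (Ps d - X d))
      ≤ lyapunov ρ φ ψ κ Ps y P₀ X₀ u₀ := by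
  obtain ⟨hPb, hg⟩ := (M.isArgmin_objP_iff hρ hφ P₀ X₀ u₀ P).1 hP
  have hzero : ∑ d, (M.gradP ρ φ P₀ X₀ u₀ P d - (M.marginal Ps d + y d)) * (P d - Ps d) = 0 :=
    sum_mul_eq_zero_of_symm (D := P - Ps)
      (g := fun d => M.gradP ρ φ P₀ X₀ u₀ P d - (M.marginal Ps d + y d))
      (fun d => by rw [hg d, hy.symm d]) (sub_mem_balanceSet hPb hPs)
  -- The unscaled dual variable is `ρ * u`. As `u` itself moves by `κ * ρ` times the residual, the
  -- relaxation factor is `γ = κ * ρ`.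
  have hcoord := Finset.sum_le_sum fun (d : G.Dart) (_ : d ∈ Finset.univ) =>
    prox_descent_coordinate (φ := φ) (ψ := ψ) hρ (mul_pos hκ hρ) hμ₁ hμ₂ (P d) (P₀ d) (X d) (X₀ d)
      (ρ * u₀ d) (Ps d) (y d)
  have hsplit : ∑ d, ((ρ * (P d - X₀ d) + ρ * u₀ d - y d + φ * (P d - P₀ d)) * (P d - Ps d)
        - (ρ * (P₀ d - X d) + ρ * u₀ d - ψ * (X d - X₀ d) - y d) * (X d - Ps d))
      = ∑ d, (M.gradP ρ φ P₀ X₀ u₀ P d - (M.marginal Ps d + y d)) * (P d - Ps d)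
        - ∑ d, (M.marginal P d - M.marginal Ps d) * (P d - Ps d)
        - ∑ d, gradX ρ ψ P₀ X₀ u₀ X d * (Ps d - X d) + ∑ d, y d * (X d - Ps d) := by
    simp only [← Finset.sum_sub_distrib, ← Finset.sum_add_distrib]
    refine Finset.sum_congr rfl fun d _ => ?_
    rw [gradP, gradX]
    ring
  rw [hzero, sum_marginal_sub] at hsplit
  have hn := hy.normal X hX
  have hu : lyapunov ρ φ ψ κ Ps y P X (u₀ + (κ * ρ) • (P - X))
      = ∑ d, ((φ + ρ) * (P d - Ps d) ^ 2 + (ψ + ρ) * (X d - Ps d) ^ 2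
        + 1 / (κ * ρ * ρ) * (ρ * u₀ d + κ * ρ * ρ * (P d - X d) - y d) ^ 2) := by
    refine Finset.sum_congr rfl fun d _ => ?_
    simp only [Pi.add_apply, Pi.smul_apply, Pi.sub_apply, smul_eq_mul]
    ring
  rw [hu]
  simp only [Finset.sum_add_distrib, ← Finset.mul_sum] at hcoord hsplit ⊢
  simp only [lyapunov, sqNorm, Pi.sub_apply, Finset.sum_add_distrib, ← Finset.mul_sum]
  linarith

end Market
end

/-! ### Convergence of the algorithm -/

section

variable {V : Type*} [Fintype V] [DecidableEq V] {G : SimpleGraph V} [DecidableRel G.Adj]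

namespace Market

variable {M : Market G} {signs : Prop}

theorem lyapunov_nonneg {ρ φ ψ κ : ℝ} (hρ : 0 < ρ) (hφ : 0 < φ) (hψ : 0 < ψ) (hκ : 0 < κ)
    (Ps y P X u : G.Dart → ℝ) : 0 ≤ lyapunov ρ φ ψ κ Ps y P X u :=
  Finset.sum_nonneg fun d _ => by positivity

theorem IsRun.tendsto {ρ φ ψ κ : ℝ} {Ps : G.Dart → ℝ} {P X u lam : ℕ → G.Dart → ℝ}
    (h : M.IsRun signs ρ φ ψ κ P X u lam) (hρ : 0 < ρ) (hρ1 : ρ ≤ 1) (hc : ProxCond ρ φ ψ κ)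
    (hPs : M.IsOptimal signs Ps)
    (hint : ∀ i, IsTrader Ps i → M.pmin i < rowSum Ps i ∧ rowSum Ps i < M.pmax i) :
    (∀ i, Tendsto (fun k => rowSum (P k) i) atTop (𝓝 (rowSum Ps i))) ∧
      ∀ d, IsTrade signs Ps d → Tendsto (fun k => lam k d) atTop (𝓝 (M.marginal Ps d)) := by
  obtain ⟨hφ, hψ, hκ, μ₁, μ₂, hμ₁, hμ₂, hφμ, hψμ, hμ⟩ := hc
  obtain ⟨y, hy⟩ := IsOptimal.exists_isDualSolution hPs
  -- This is where `ρ ≤ 1` enters: the relaxation factor `κ * ρ` then satisfies the bound assumed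
  -- for `κ`.
  have hκρ : κ * ρ ≤ κ := mul_le_of_le_one_right hκ.le hρ1
  have c₀ : 0 < ρ * (2 - κ * ρ - μ₁ - μ₂) := mul_pos hρ (by linarith)
  have c₁ : 0 < φ + ρ - ρ * (1 / μ₁) := by linarith
  have c₂ : 0 < ψ + ρ - ρ * (1 / μ₂) := by linarith
  let slack : ℕ → ℝ := fun k => ∑ d, gradX ρ ψ (P k) (X k) (u k) (X (k + 1)) d * (Ps d - X (k + 1) d)
  have hs : ∀ k, 0 ≤ slack k := fun k => objX_variation_nonneg (h.stepX k) hPs.1.2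
  have hcurv : ∀ k, 0 ≤ M.curvature (P (k + 1) - Ps) := fun k => M.curvature_nonneg _
  let w : ℕ → ℝ := fun k => ρ * (2 - κ * ρ - μ₁ - μ₂) * sqNorm (P (k + 1) - X (k + 1))
    + (φ + ρ - ρ * (1 / μ₁)) * sqNorm (P (k + 1) - P k)
    + (ψ + ρ - ρ * (1 / μ₂)) * sqNorm (X (k + 1) - X k)
    + 4 * M.curvature (P (k + 1) - Ps) + 2 * slack k
  have hr : ∀ k, 0 ≤ ρ * (2 - κ * ρ - μ₁ - μ₂) * sqNorm (P (k + 1) - X (k + 1)) :=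
    fun k => mul_nonneg c₀.le (sqNorm_nonneg _)
  have hp : ∀ k, 0 ≤ (φ + ρ - ρ * (1 / μ₁)) * sqNorm (P (k + 1) - P k) :=
    fun k => mul_nonneg c₁.le (sqNorm_nonneg _)
  have hx : ∀ k, 0 ≤ (ψ + ρ - ρ * (1 / μ₂)) * sqNorm (X (k + 1) - X k) :=
    fun k => mul_nonneg c₂.le (sqNorm_nonneg _)
  have hw : Tendsto w atTop (𝓝 0) := by
    refine tendsto_zero_of_descent (v := fun k => lyapunov ρ φ ψ κ Ps y (P k) (X k) (u k))
      (fun k => lyapunov_nonneg hρ hφ hψ hκ _ _ _ _ _)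
      (fun k => by linarith [hr k, hp k, hx k, hcurv k, hs k]) fun k => ?_
    simp only [h.stepU k]
    exact lyapunov_descent hρ hφ hκ hμ₁ hμ₂ hPs.1.1 hy (h.stepX k).1 (h.stepP k)
  have hrow : ∀ i, Tendsto (fun k => rowSum (P (k + 1)) i) atTop (𝓝 (rowSum Ps i)) := fun i => by
    have h1 : Tendsto (fun k => rowSum (P (k + 1) - Ps) i) atTop (𝓝 0) := by
      refine tendsto_zero_of_sq_le (mul_pos four_pos (M.a_pos i)) hw fun k => ?_
      have : M.a i * rowSum (P (k + 1) - Ps) i ^ 2 ≤ M.curvature (P (k + 1) - Ps) :=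
        Finset.single_le_sum (f := fun i => M.a i * rowSum (P (k + 1) - Ps) i ^ 2)
          (fun i _ => mul_nonneg (M.a_pos i).le (sq_nonneg _)) (Finset.mem_univ i)
      linarith [hr k, hp k, hx k, hs k]
    simpa [rowSum_sub] using h1.add_const (rowSum Ps i)
  refine ⟨fun i => (tendsto_add_atTop_iff_nat 1).1 (hrow i), fun d hd => ?_⟩
  rw [← tendsto_add_atTop_iff_nat 1]
  have hΔp : Tendsto (fun k => P (k + 1) d - P k d) atTop (𝓝 0) :=
    tendsto_zero_of_sq_le c₁ hw fun k => by
      have := mul_le_mul_of_nonneg_left (sq_le_sqNorm (P (k + 1) - P k) d) c₁.le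
      simp only [Pi.sub_apply] at this
      linarith [hr k, hx k, hcurv k, hs k]
  have hΔx : Tendsto (fun k => X (k + 1) d - X k d) atTop (𝓝 0) :=
    tendsto_zero_of_sq_le c₂ hw fun k => by
      have := mul_le_mul_of_nonneg_left (sq_le_sqNorm (X (k + 1) - X k) d) c₂.le
      simp only [Pi.sub_apply] at this
      linarith [hr k, hp k, hcurv k, hs k]
  -- The variational inequality at the perturbations of `Ps` by `ε` and `-ε` gives `ε * |gradX| ≤
  -- slack`, and the slack tends to zero.
  have hgrad : Tendsto (fun k => gradX ρ ψ (P k) (X k) (u k) (X (k + 1)) d) atTop (𝓝 0) := by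
    obtain ⟨ε, hε, h1, h2⟩ := exists_perturbation hPs.1.2 hint hd
    refine squeeze_zero_norm (fun k => ?_) (by simpa using hw.div_const ε)
    have k1 := objX_variation_nonneg (h.stepX k) h1
    have k2 := objX_variation_nonneg (h.stepX k) h2
    rw [sum_mul_perturb_sub] at k1 k2
    change 0 ≤ slack k + _ at k1
    change 0 ≤ slack k + _ at k2
    have : slack k ≤ w k := by linarith [hr k, hp k, hx k, hcurv k, hs k]
    rw [Real.norm_eq_abs, abs_le, ← neg_div, div_le_iff₀ hε, le_div_iff₀ hε]
    constructor <;> linarith [hr k, hp k, hx k, hcurv k, hs k]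
  have hmarg : Tendsto (fun k => M.marginal (P (k + 1)) d) atTop (𝓝 (M.marginal Ps d)) :=
    (((hrow d.fst).const_mul _).add_const _).add_const _
  -- Adding the gradients of the two updates cancels `u`; only increments remain besides the
  -- marginal cost.
  have hlam : ∀ k, lam (k + 1) d = M.marginal (P (k + 1)) d
      + (ρ + φ) * (P (k + 1) d - P k d) + (ρ + ψ) * (X (k + 1) d - X k d)
      - gradX ρ ψ (P k) (X k) (u k) (X (k + 1)) d := fun k => by
    rw [((M.isMultiplier_objP_iff _ _ _ _ _ _ _).1 (h.price k)).2 d, gradP, gradX]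
    ring
  simp only [hlam]
  simpa using ((hmarg.add (hΔp.const_mul (ρ + φ))).add (hΔx.const_mul (ρ + ψ))).sub hgrad

theorem IsOptimal.marginal_symm {Ps : G.Dart → ℝ} (hPs : M.IsOptimal signs Ps)
    (hint : ∀ i, IsTrader Ps i → M.pmin i < rowSum Ps i ∧ rowSum Ps i < M.pmax i)
    {d : G.Dart} (hd : IsTrade signs Ps d) : M.marginal Ps d = M.marginal Ps d.symm := by
  obtain ⟨y, hy⟩ := IsOptimal.exists_isDualSolution hPs
  have hd' : IsTrade signs Ps d.symm := ⟨hd.2.1, hd.1, fun hs h0 => hd.2.2 hs (by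
    have := hPs.1.1 d
    linarith)⟩
  have := hy.symm d
  rwa [hy.eq_zero hPs.1.2 hint hd, hy.eq_zero hPs.1.2 hint hd', add_zero, add_zero] at this

end Market

/-! ### Trade graph, clusters and power balance -/

variable {signs : Prop} {P : G.Dart → ℝ}

theorem mem_traders {i : V} : i ∈ traders P ↔ IsTrader P i := by simp [traders]

theorem mem_cluster {i j : V} : j ∈ cluster signs P i ↔ (tradeGraph signs P).Reachable i j := by
  simp [cluster]

theorem IsTrade.symm (hP : P ∈ balanceSet G) {d : G.Dart} (hd : IsTrade signs P d) :
    IsTrade signs P d.symm :=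
  ⟨hd.2.1, hd.1, fun hs h0 => hd.2.2 hs (by have := hP d; linarith)⟩

theorem tradeGraph_adj (hP : P ∈ balanceSet G) {i j : V} :
    (tradeGraph signs P).Adj i j ↔ ∃ d : G.Dart, d.fst = i ∧ d.snd = j ∧ IsTrade signs P d := by
  rw [tradeGraph, SimpleGraph.fromRel_adj]
  constructor
  · rintro ⟨-, h | ⟨d, h1, h2, h⟩⟩
    · exact h
    · exact ⟨d.symm, h2, h1, h.symm hP⟩
  · rintro ⟨d, rfl, rfl, h⟩
    exact ⟨d.adj.ne, .inl ⟨d, rfl, rfl, h⟩⟩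

/-- A nonzero power makes both ends traders and the pair a trade. -/
theorem isTrade_of_ne_zero (hP : P ∈ balanceSet G) {d : G.Dart} (hd : P d ≠ 0) :
    IsTrade signs P d :=
  ⟨⟨d, rfl, hd⟩, ⟨d.symm, rfl, fun h0 => hd (by have := hP d; linarith)⟩, fun _ => hd⟩

/-- A function that agrees at both ends of each trade is constant on connected clusters. -/
theorem eq_of_reachable (hP : P ∈ balanceSet G) {α : Type*} {f : V → α}
    (hf : ∀ d : G.Dart, IsTrade signs P d → f d.fst = f d.snd) {i j : V}
    (h : (tradeGraph signs P).Reachable i j) : f i = f j := by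
  obtain ⟨p⟩ := h
  induction p with
  | nil => rfl
  | cons hadj _ ih =>
    obtain ⟨d, rfl, rfl, hd⟩ := (tradeGraph_adj hP).1 hadj
    exact (hf d hd).trans ih

/-- The powers traded within a set of peers closed under trade balance out. -/
theorem sum_rowSum_eq_zero (hP : P ∈ balanceSet G) (S : Finset V)
    (hS : ∀ d : G.Dart, P d ≠ 0 → d.fst ∈ S → d.snd ∈ S) : ∑ i ∈ S, rowSum P i = 0 := by
  have h1 : ∑ i ∈ S, rowSum P i = ∑ d : G.Dart with d.fst ∈ S ∧ P d ≠ 0, P d := by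
    have := sum_mul_rowSum (fun i => if i ∈ S then 1 else 0) P
    simp only [ite_mul, one_mul, zero_mul, Finset.sum_ite_mem, Finset.univ_inter] at this
    rw [this, ← Finset.filter_filter, Finset.sum_filter_ne_zero, Finset.sum_filter]
  rw [h1]
  -- Opposite darts cancel; discarding zero entries first lets `hS` keep the reversed dart in the
  -- index set.
  refine Finset.sum_involution (fun d _ => d.symm) (fun d _ => hP d)
    (fun d _ _ => d.symm_ne) (fun d hd => ?_) (fun d _ => d.symm_symm)
  obtain ⟨-, h2, h3⟩ := Finset.mem_filter.1 hd
  exact Finset.mem_filter.2 ⟨Finset.mem_univ _, hS d h3 h2,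
    fun h0 => h3 (by have := hP d; linarith)⟩

theorem isTrader_of_mem_cluster (hP : P ∈ balanceSet G) {i j : V} (hi : IsTrader P i)
    (hj : j ∈ cluster signs P i) : IsTrader P j :=
  (eq_of_reachable (f := IsTrader P) hP (fun _ hd => propext (iff_of_true hd.1 hd.2.1))
    (mem_cluster.1 hj)).mp hi

theorem cluster_eq_traders (hP : P ∈ balanceSet G) (hc : TradersConnected signs P) {i : V}
    (hi : IsTrader P i) : cluster signs P i = traders P := by
  ext j
  rw [mem_traders]
  exact ⟨isTrader_of_mem_cluster hP hi, fun hj => mem_cluster.2 (hc i j hi hj)⟩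

theorem sum_rowSum_cluster (hP : P ∈ balanceSet G) (i : V) :
    ∑ j ∈ cluster signs P i, rowSum P j = 0 :=
  sum_rowSum_eq_zero hP _ fun d hd h => mem_cluster.2 <| (mem_cluster.1 h).trans
    (SimpleGraph.Adj.reachable ((tradeGraph_adj hP).2 ⟨d, rfl, rfl, isTrade_of_ne_zero hP hd⟩))

theorem sum_rowSum_traders (hP : P ∈ balanceSet G) : ∑ j ∈ traders P, rowSum P j = 0 :=
  sum_rowSum_eq_zero hP _ fun _ hd _ =>
    mem_traders.2 (isTrade_of_ne_zero (signs := False) hP hd).2.1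

/-! ### Explicit prices and powers -/

namespace Market

variable (M : Market G)

theorem sum_inv_pos {S : Finset V} (hS : S.Nonempty) : 0 < ∑ j ∈ S, 1 / (2 * M.a j) :=
  Finset.sum_pos (fun j _ => by have := M.a_pos j; positivity) hS

/-- If the marginal cost is the same for all peers in `S` and their powers sum to zero, it is the
common price. -/
theorem commonPrice_eq {S : Finset V} {p : V → ℝ} {i : V} (hi : i ∈ S)
    (hp : ∀ j ∈ S, 2 * M.a i * p i + M.b i = 2 * M.a j * p j + M.b j)
    (hsum : ∑ j ∈ S, p j = 0) : 2 * M.a i * p i + M.b i = M.commonPrice S := by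
  -- Average the common marginal cost with weights `1 / (2 * M.a j)`: the difference of the two
  -- sides is then the sum of the powers, which vanishes.
  rw [commonPrice, eq_div_iff (M.sum_inv_pos ⟨i, hi⟩).ne', Finset.mul_sum, ← sub_eq_zero,
    ← Finset.sum_sub_distrib, ← hsum]
  refine Finset.sum_congr rfl fun j hj => ?_
  have := (M.a_pos j).ne'
  rw [hp j hj]
  field_simp
  ring

theorem commonPower_eq (S : Finset V) (i : V) :
    M.commonPower S i = (M.commonPrice S - M.b i) / (2 * M.a i) := by
  rw [commonPower, commonPrice, sub_div, div_div, mul_comm (2 * M.a i)]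

variable {M}

theorem IsOptimal.cluster_formula {Ps : G.Dart → ℝ} (hPs : M.IsOptimal signs Ps)
    (hint : ∀ i, IsTrader Ps i → M.pmin i < rowSum Ps i ∧ rowSum Ps i < M.pmax i)
    (hw : ∀ d, M.w d = 0) (i : V) :
    2 * M.a i * rowSum Ps i + M.b i = M.commonPrice (cluster signs Ps i) := by
  refine M.commonPrice_eq (mem_cluster.2 (SimpleGraph.Reachable.refl i)) (fun j hj => ?_)
    (sum_rowSum_cluster hPs.1.1 i)
  refine eq_of_reachable (f := fun i => 2 * M.a i * rowSum Ps i + M.b i) hPs.1.1 (fun d hd => ?_)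
    (mem_cluster.1 hj)
  simpa [marginal, hw] using hPs.marginal_symm hint hd

theorem IsOptimal.rowSum_eq_commonPower {Ps : G.Dart → ℝ} (hPs : M.IsOptimal signs Ps)
    (hint : ∀ i, IsTrader Ps i → M.pmin i < rowSum Ps i ∧ rowSum Ps i < M.pmax i)
    (hw : ∀ d, M.w d = 0) (i : V) :
    rowSum Ps i = M.commonPower (cluster signs Ps i) i := by
  have := M.a_pos i
  rw [commonPower_eq, ← hPs.cluster_formula hint hw, eq_div_iff (by positivity)]
  ring

theorem IsOptimal.marginal_eq_commonPrice {Ps : G.Dart → ℝ} (hPs : M.IsOptimal signs Ps)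
    (hint : ∀ i, IsTrader Ps i → M.pmin i < rowSum Ps i ∧ rowSum Ps i < M.pmax i)
    (hw : ∀ d, M.w d = 0) (d : G.Dart) :
    M.marginal Ps d = M.commonPrice (cluster signs Ps d.fst) := by
  rw [marginal, hw, add_zero, hPs.cluster_formula hint hw]

theorem IsOptimal.solvesPowerSystem {Ps : G.Dart → ℝ} (hPs : M.IsOptimal signs Ps)
    (hint : ∀ i, IsTrader Ps i → M.pmin i < rowSum Ps i ∧ rowSum Ps i < M.pmax i) :
    M.SolvesPowerSystem signs Ps (rowSum Ps) := by
  refine ⟨fun d hd => ?_, ?_⟩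
  · have := hPs.marginal_symm hint hd
    simp only [marginal, dart_symm_fst] at this
    linarith
  · rw [← sum_rowSum_traders hPs.1.1]
    refine Finset.sum_congr rfl fun i _ => ?_
    have := (M.a_pos i).ne'
    field_simp

/-- The scaled difference of two solutions is constant along trades, and its sum with positive
weights is zero, so the constant is zero. -/
theorem SolvesPowerSystem.eq_of_tradersConnected {P : G.Dart → ℝ} (hP : P ∈ balanceSet G)
    (hc : TradersConnected signs P) {p q : V → ℝ} (hp : M.SolvesPowerSystem signs P p)
    (hq : M.SolvesPowerSystem signs P q) {i : V} (hi : IsTrader P i) : q i = p i := by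
  have hconst : ∀ j ∈ traders P,
      2 * M.a i * q i - 2 * M.a i * p i = 2 * M.a j * q j - 2 * M.a j * p j := fun j hj =>
    eq_of_reachable (f := fun i => 2 * M.a i * q i - 2 * M.a i * p i) hP
      (fun d hd => by linarith [hp.1 d hd, hq.1 d hd]) (hc i j hi (mem_traders.1 hj))
  have hsum : (∑ j ∈ traders P, 1 / (2 * M.a j)) * (2 * M.a i * q i - 2 * M.a i * p i) = 0 := by
    rw [Finset.sum_mul, ← sub_eq_zero.2 (hq.2.trans hp.2.symm), ← Finset.sum_sub_distrib]
    exact Finset.sum_congr rfl fun j hj => by rw [hconst j hj]; ring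
  have h0 := (mul_eq_zero.1 hsum).resolve_left (M.sum_inv_pos ⟨i, mem_traders.2 hi⟩).ne'
  rw [← mul_sub] at h0
  exact sub_eq_zero.1 ((mul_eq_zero.1 h0).resolve_left (by have := M.a_pos i; positivity))

end Market
end

theorem theorem2 {V : Type*} [Fintype V] [DecidableEq V] {G : SimpleGraph V}
    [DecidableRel G.Adj] (M : Market G) :
    -- the P-update, from arbitrary current iterates `Pk`, `Xk`, `uk`
    (∀ (ρ φ : ℝ) (Pk Xk uk : G.Dart → ℝ), 0 < ρ → 0 < φ →
      (∃! P, IsArgmin (M.objP ρ φ Pk Xk uk) (balanceSet G) P) ∧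
      ∀ P, IsArgmin (M.objP ρ φ Pk Xk uk) (balanceSet G) P →
        (∀ d : G.Dart, P d =
          (M.v ρ φ Pk Xk uk d.symm + 2 * M.a d.snd * rowSum P d.snd
            - M.v ρ φ Pk Xk uk d - 2 * M.a d.fst * rowSum P d.fst) / (2 * (ρ + φ))) ∧
        (∀ lam : G.Dart → ℝ, IsMultiplier (M.objP ρ φ Pk Xk uk) P lam ↔
          ∀ d : G.Dart, lam d =
            (M.v ρ φ Pk Xk uk d.symm + 2 * M.a d.snd * rowSum P d.snd
              + M.v ρ φ Pk Xk uk d + 2 * M.a d.fst * rowSum P d.fst) / 2) ∧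
        (∀ y : V → ℝ,
          (G.lapMatrix ℝ + M.Gam ρ φ) *ᵥ y
              = (fun i => rowSum (fun d => M.v ρ φ Pk Xk uk d.symm) i)
                - (fun i => rowSum (M.v ρ φ Pk Xk uk) i)
            ↔ y = fun i => 2 * M.a i * rowSum P i)) ∧
    -- the limit `k → ∞`, then `ρ → 0`
    (∀ (signs : Prop) (Ps : G.Dart → ℝ), M.IsOptimal signs Ps →
      (∀ i, IsTrader Ps i → M.pmin i < rowSum Ps i ∧ rowSum Ps i < M.pmax i) →
      (∃ (p : ℝ → V → ℝ) (l : ℝ → G.Dart → ℝ),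
        (∀ ρ φ ψ κ : ℝ, 0 < ρ → ρ ≤ 1 → ProxCond ρ φ ψ κ →
          ∀ P X u lam : ℕ → G.Dart → ℝ, M.IsRun signs ρ φ ψ κ P X u lam →
            (∀ i, Tendsto (fun k => rowSum (P k) i) atTop (𝓝 (p ρ i))) ∧
            (∀ d, IsTrade signs Ps d →
              Tendsto (fun k => lam k d) atTop (𝓝 (l ρ d)))) ∧
        (∀ i, Tendsto (fun ρ => p ρ i) (𝓝[>] 0) (𝓝 (rowSum Ps i))) ∧
        (∀ d, IsTrade signs Ps d →
          Tendsto (fun ρ => l ρ d) (𝓝[>] 0) (𝓝 (M.marginal Ps d)))) ∧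
      -- both members of a pair have the same price
      (∀ d, IsTrade signs Ps d → M.marginal Ps d = M.marginal Ps d.symm) ∧
      -- no trade weights, connected
      ((∀ d, M.w d = 0) → TradersConnected signs Ps →
        (∀ i, IsTrader Ps i → rowSum Ps i = M.commonPower (traders Ps) i) ∧
        (∀ d, IsTrade signs Ps d → M.marginal Ps d = M.commonPrice (traders Ps))) ∧
      -- no trade weights, cluster by cluster
      ((∀ d, M.w d = 0) →
        (∀ i, IsTrader Ps i → rowSum Ps i = M.commonPower (cluster signs Ps i) i) ∧
        (∀ d, IsTrade signs Ps d →
          M.marginal Ps d = M.commonPrice (cluster signs Ps d.fst))) ∧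
      -- arbitrary trade weights
      M.SolvesPowerSystem signs Ps (rowSum Ps) ∧
      (TradersConnected signs Ps → ∀ q, M.SolvesPowerSystem signs Ps q →
        ∀ i, IsTrader Ps i → q i = rowSum Ps i)) := by
  refine ⟨fun ρ φ Pk Xk uk hρ hφ => ⟨M.existsUnique_isArgmin_objP hρ hφ Pk Xk uk, fun P hP =>
    ⟨fun d => ?_, fun lam => ?_, M.lapMatrix_add_Gam_mulVec_eq_iff_of_isArgmin hρ hφ hP⟩⟩,
    -- The limits in `k` are chosen independent of `ρ`, so those as `ρ → 0` are limits of constants.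
    fun signs Ps hPs hint => ⟨⟨fun _ => rowSum Ps, fun _ => M.marginal Ps,
      fun ρ φ ψ κ hρ hρ1 hc P X u lam h => h.tendsto hρ hρ1 hc hPs hint,
      fun i => tendsto_const_nhds, fun d _ => tendsto_const_nhds⟩,
      fun d => hPs.marginal_symm hint, fun hw hc => ⟨fun i hi => ?_, fun d hd => ?_⟩,
      fun hw => ⟨fun i _ => hPs.rowSum_eq_commonPower hint hw i,
        fun d _ => hPs.marginal_eq_commonPrice hint hw d⟩,
      hPs.solvesPowerSystem hint, fun hc q hq i hi =>
        (hPs.solvesPowerSystem hint).eq_of_tradersConnected hPs.1.1 hc hq hi⟩⟩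
  · exact congr_fun ((M.isArgmin_objP_iff_eq_updateP hρ hφ Pk Xk uk P).1 hP) d
  · rw [M.isMultiplier_objP_iff]
    simp only [M.gradP_eq_of_isArgmin hρ hφ hP]
    refine and_iff_right fun d => ?_
    simp only [dart_symm_fst, dart_symm_snd, SimpleGraph.Dart.symm_symm]
    ring
  · rw [← cluster_eq_traders hPs.1.1 hc hi]
    exact hPs.rowSum_eq_commonPower hint hw i
  · rw [← cluster_eq_traders hPs.1.1 hc hd.1]
    exact hPs.marginal_eq_commonPrice hint hw d
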